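/- Consider the control-affine system $\dot x(t) = g(x(t),u(t),w(t)) := f(x(t),w(t)) + G(x(t))u(t)$ with $f:\mathbb R^{n_x}\times\mathbb R^{n_w}\to\mathbb R^{n_x}$ and $G:\mathbb R^{n_x}\to\mathbb R^{n_x\times n_u}$. Let $U\subseteq\mathbb R^{n_u}$ and $W\subseteq\mathbb R^{n_w}$ be compact and convex, with $U$ having non-empty interior; let $f$ be jointly continuous and locally Lipschitz in $x$, locally uniformly in $w$; and let $G$ be continuously differentiable. For a non-empty compact set $Z\subseteq\mathbb R^{n_x}$ and $c\in\mathbb R^{n_x}$ write $V[Z](c):=\max_{z\in Z}c^{\mathsf T}z$, and for $\nu\in U$ put $$\Gamma_g(\nu,c,Z):=\{\,g(\xi,\nu,\omega)\;:\;\xi\in Z,\ c^{\mathsf T}\xi=V[Z](c),\ \omega\in W\,\}.$$ Let $Y$ assign to each $t\in[t_1,t_2]$ a non-empty compact convex set $Y(t)\subseteq\mathbb R^{n_x}$ such that 1. for every $c\in\mathbb R^{n_x}$ the function $t\mapsto V[Y(t)](c)$ is Lipschitz continuous on $[t_1,t_2]$; 2. for almost every $t\in[t_1,t_2]$ and all $c\in\mathbb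 R^{n_x}$, the time derivative $\dot V[Y(t)](c)$ exists and $$\dot V[Y(t)](c)\ \ge\ \min_{\nu\in U}V[\Gamma_g(\nu,c,Y(t))](c).$$ Then $Y$ is a robust forward invariant tube on $[t_1,t_2]$. That is, there is a measurable, locally integrable feedback law $\mu:[t_1,t_2]\times\mathbb R^{n_x}\to U$ such that, for every locally integrable $w:\mathbb R\to\mathbb R^{n_w}$ with values in $W$ and every absolutely continuous solution $x$ on an interval $[a,b]\subseteq[t_1,t_2]$ of $$\dot x(t)=f(x(t),w(t))+G(x(t))\mu(t,x(t))\quad\text{for a.e. }t\in[a,b],\qquad x(a)\in Y(a),$$ one has $x(t)\in Y(t)$ for all $t\in[a,b]$. -/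

import Mathlib

open Set MeasureTheory

noncomputable section

namespace MinMaxDI

/-- The Euclidean space `ℝⁿ`. -/
abbrev Eu (n : ℕ) : Type := EuclideanSpace ℝ (Fin n)

/-- The support function `V[Z](c) = max {cᵀz | z ∈ Z}` (used for nonempty compact `Z` only, where the
supremum is attained). -/
def supportFn {n : ℕ} (Z : Set (Eu n)) (c : Eu n) : ℝ :=
  sSup ((fun z : Eu n => inner ℝ c z) '' Z)

/-- The right-hand side `g(x,u,w) = f(x,w) + G(x)u` of the control-affine system; the matrix `G(x)`
is given as a linear map. -/
def rhs {nx nu nw : ℕ} (f : Eu nx → Eu nw → Eu nx) (G : Eu nx → (Eu nu →L[ℝ] Eu nx))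
    (x : Eu nx) (u : Eu nu) (w : Eu nw) : Eu nx :=
  f x w + G x u

/-- `Γ_g(ν,c,Z) = {g(ξ,ν,ω) | cᵀξ = V[Z](c), ξ ∈ Z, ω ∈ W}`. -/
def Gam {nx nu nw : ℕ} (f : Eu nx → Eu nw → Eu nx) (G : Eu nx → (Eu nu →L[ℝ] Eu nx))
    (W : Set (Eu nw)) (ν : Eu nu) (c : Eu nx) (Z : Set (Eu nx)) : Set (Eu nx) :=
  {y | ∃ ξ ω, inner ℝ c ξ = supportFn Z c ∧ ξ ∈ Z ∧ ω ∈ W ∧ y = rhs f G ξ ν ω}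

/-- `min_{ν ∈ U} V[Γ_g(ν,c,Z)](c)`. -/
def minMax {nx nu nw : ℕ} (f : Eu nx → Eu nw → Eu nx) (G : Eu nx → (Eu nu →L[ℝ] Eu nx))
    (U : Set (Eu nu)) (W : Set (Eu nw)) (c : Eu nx) (Z : Set (Eu nx)) : ℝ :=
  sInf ((fun ν : Eu nu => supportFn (Gam f G W ν c Z) c) '' U)

/-- `f(x,w)` is locally Lipschitz in `x`, locally uniformly in `w`. -/
def LocLipschitzInState {nx nw : ℕ} (f : Eu nx → Eu nw → Eu nx) : Prop :=
  ∀ (x₀ : Eu nx) (w₀ : Eu nw), ∃ K : NNReal, ∃ A ∈ nhds x₀, ∃ B ∈ nhds w₀,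
    ∀ w ∈ B, LipschitzOnWith K (fun x => f x w) A

/-- The admissible disturbances: locally integrable functions of time with values in `W`. -/
def Disturbance {nw : ℕ} (W : Set (Eu nw)) (w : ℝ → Eu nw) : Prop :=
  LocallyIntegrable w volume ∧ ∀ t, w t ∈ W

/-- `x` is a (Carathéodory) solution on `[a,b]` of `ẋ = f(x,w) + G(x) μ(t,x)`: it is absolutely
continuous and satisfies the equation for almost every time. -/
def IsSolution {nx nu nw : ℕ} (f : Eu nx → Eu nw → Eu nx) (G : Eu nx → (Eu nu →L[ℝ] Eu nx))
    (μ : ℝ → Eu nx → Eu nu) (w : ℝ → Eu nw) (a b : ℝ) (x : ℝ → Eu nx) : Prop :=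
  AbsolutelyContinuousOnInterval x a b ∧
    ∀ᵐ t ∂(volume.restrict (Icc a b)), HasDerivAt x (rhs f G (x t) (μ t (x t)) (w t)) t

/-- `Y` is a robust forward invariant tube on `[t₁,t₂]`: some jointly measurable, locally integrable
feedback law `μ : [t₁,t₂] × ℝⁿ → U` keeps in `Y`, for every admissible disturbance, every
closed-loop solution that starts in `Y` at some time `a ∈ [t₁,t₂]`. -/
def IsRFIT {nx nu nw : ℕ} (f : Eu nx → Eu nw → Eu nx) (G : Eu nx → (Eu nu →L[ℝ] Eu nx))
    (U : Set (Eu nu)) (W : Set (Eu nw)) (t₁ t₂ : ℝ) (Y : ℝ → Set (Eu nx)) : Prop :=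
  ∃ μ : ℝ → Eu nx → Eu nu,
    Measurable (fun p : ℝ × Eu nx => μ p.1 p.2) ∧
    LocallyIntegrableOn (fun p : ℝ × Eu nx => μ p.1 p.2) (Icc t₁ t₂ ×ˢ univ) volume ∧
    (∀ t ∈ Icc t₁ t₂, ∀ x, μ t x ∈ U) ∧
    ∀ w : ℝ → Eu nw, Disturbance W w →
      ∀ a b : ℝ, t₁ ≤ a → a ≤ b → b ≤ t₂ →
        ∀ x : ℝ → Eu nx, IsSolution f G μ w a b x → x a ∈ Y a →
          ∀ t ∈ Icc a b, x t ∈ Y t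

end MinMaxDI

end

/-!
Suppose `x t ∉ Y t` and let `c` be the vector from the nearest point of `Y t` to `x t`. The distance
`d t = ‖c‖` is the maximum of `⟪e, x t⟫ - supportFn (Y t) e` over unit vectors `e`, attained at
`c / ‖c‖`, so by the envelope theorem `‖c‖ * d' = ⟪c, x'⟫ - v`, where `v` is the derivative of
`s ↦ supportFn (Y s) c` at `t`. A feedback that minimises the worst-case velocity in the direction
`c` up to a margin `‖c‖ ^ 2` can be chosen measurably, since the worst-case velocity is upper
semicontinuous. With it, the min-max inequality at the nearest point and a Lipschitz bound for the
right-hand side give `d' ≤ (K + 1) * d`. The distance need not be absolutely continuous, but its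
increments are bounded above by a multiple of the elapsed time, which is enough for Grönwall's
inequality.
-/

namespace MinMaxDI

open Filter Topology
open scoped NNReal InnerProductSpace

section OneSidedLipschitz

/-- `φ` grows on `S` at most at the rate `L`. Only upper bounds on increments are required: this is
the regularity of the distance from a solution to the tube, whose lower increments are not
controlled by the differential inequality. -/
def OneSidedLipschitzOn (L : ℝ≥0) (φ : ℝ → ℝ) (S : Set ℝ) : Prop :=
  ∀ ⦃s⦄, s ∈ S → ∀ ⦃t⦄, t ∈ S → s ≤ t → φ t - φ s ≤ L * (t - s)

variable {φ d : ℝ → ℝ} {S : Set ℝ} {a b : ℝ} {L : ℝ≥0}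

theorem OneSidedLipschitzOn.mono {S' : Set ℝ} (hφ : OneSidedLipschitzOn L φ S) (h : S' ⊆ S) :
    OneSidedLipschitzOn L φ S' :=
  fun _ hs _ ht hst => hφ (h hs) (h ht) hst

theorem OneSidedLipschitzOn.monotoneOn (hφ : OneSidedLipschitzOn L φ S) :
    MonotoneOn (fun t => L * t - φ t) S := by
  intro s hs t ht hst
  linarith [hφ hs ht hst]

theorem ae_restrict_Icc_mem_Ioo (a b : ℝ) : ∀ᵐ t ∂(volume.restrict (Icc a b)), t ∈ Ioo a b := by
  rw [← restrict_Ioo_eq_restrict_Icc]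
  exact ae_restrict_mem measurableSet_Ioo

theorem intervalIntegral_deriv_le_sub_of_monotoneOn (hab : a ≤ b) (hφ : MonotoneOn φ (Icc a b)) :
    ∫ t in a..b, deriv φ t ≤ φ b - φ a := by
  have h0 : 0 ≤ φ b - φ a := sub_nonneg.2 (hφ (left_mem_Icc.2 hab) (right_mem_Icc.2 hab) hab)
  rw [← uIcc_of_le hab] at hφ
  have := hφ.intervalIntegral_deriv_mem_uIcc
  rw [uIcc_of_le h0] at this
  exact this.2

/-- A Lipschitz bound from above suffices here, because `t ↦ L * t - φ t` is then monotone and the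
integral of the derivative of a monotone function is at most its increment. -/
theorem OneSidedLipschitzOn.le_of_ae_hasDerivAt_nonpos (hφ : OneSidedLipschitzOn L φ (Icc a b))
    (hab : a ≤ b)
    (hd : ∀ᵐ t ∂(volume.restrict (Icc a b)), ∀ v, HasDerivAt φ v t → v ≤ 0) : φ b ≤ φ a := by
  set h : ℝ → ℝ := fun t => L * t - φ t with hh
  have hmono : MonotoneOn h (Icc a b) := hφ.monotoneOn
  have hderiv : ∀ᵐ t ∂(volume.restrict (Icc a b)), (L : ℝ) ≤ deriv h t := by
    filter_upwards [hmono.ae_differentiableWithinAt measurableSet_Icc, hd,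
      ae_restrict_Icc_mem_Ioo a b] with t hdiff hnonpos ht
    have hder : HasDerivAt h (deriv h t) t :=
      (hdiff.differentiableAt (Icc_mem_nhds ht.1 ht.2)).hasDerivAt
    have hφder : HasDerivAt φ (L - deriv h t) t := by
      simpa [hh, Pi.sub_def] using ((hasDerivAt_id t).const_mul (L : ℝ)).sub hder
    linarith [hnonpos _ hφder]
  have hint : L * (b - a) ≤ h b - h a :=
    calc L * (b - a) = ∫ _ in a..b, (L : ℝ) := by
          rw [intervalIntegral.integral_const, smul_eq_mul, mul_comm]
      _ ≤ ∫ t in a..b, deriv h t :=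
          intervalIntegral.integral_mono_ae_restrict hab intervalIntegrable_const
            (MonotoneOn.intervalIntegrable_deriv (by rwa [uIcc_of_le hab])) hderiv
      _ ≤ h b - h a := intervalIntegral_deriv_le_sub_of_monotoneOn hab hmono
  simp only [hh] at hint
  linarith

theorem OneSidedLipschitzOn.mul_exp {K : ℝ} (hd : OneSidedLipschitzOn L d (Icc a b))
    (hK : 0 ≤ K) (hd0 : ∀ t ∈ Icc a b, 0 ≤ d t) :
    OneSidedLipschitzOn L (fun t => d t * Real.exp (-(K * (t - a)))) (Icc a b) := by
  intro s hs t ht hst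
  have hexp_le : Real.exp (-(K * (t - a))) ≤ Real.exp (-(K * (s - a))) := by gcongr
  have hexp_one : Real.exp (-(K * (t - a))) ≤ 1 :=
    Real.exp_le_one_iff.2 (neg_nonpos.2 (mul_nonneg hK (sub_nonneg.2 ht.1)))
  calc d t * Real.exp (-(K * (t - a))) - d s * Real.exp (-(K * (s - a)))
      ≤ (d t - d s) * Real.exp (-(K * (t - a))) := by
        linarith [mul_le_mul_of_nonneg_left hexp_le (hd0 s hs)]
    _ ≤ L * (t - s) * Real.exp (-(K * (t - a))) := by gcongr; exact hd hs ht hst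
    _ ≤ L * (t - s) :=
        mul_le_of_le_one_right (mul_nonneg L.coe_nonneg (sub_nonneg.2 hst)) hexp_one

theorem OneSidedLipschitzOn.le_mul_exp_of_ae_hasDerivAt_le {K : ℝ}
    (hd : OneSidedLipschitzOn L d (Icc a b)) (hK : 0 ≤ K) (hd0 : ∀ t ∈ Icc a b, 0 ≤ d t)
    (hder : ∀ᵐ t ∂(volume.restrict (Icc a b)), ∀ v, HasDerivAt d v t → v ≤ K * d t)
    {t : ℝ} (ht : t ∈ Icc a b) : d t ≤ d a * Real.exp (K * (t - a)) := by
  have hsub : Icc a t ⊆ Icc a b := Icc_subset_Icc_right ht.2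
  have hweighted : d t * Real.exp (-(K * (t - a))) ≤ d a := by
    refine (((hd.mul_exp hK hd0).mono hsub).le_of_ae_hasDerivAt_nonpos ht.1 ?_).trans_eq (by simp)
    filter_upwards [ae_restrict_of_ae_restrict_of_subset hsub hder] with τ hτ v hv
    have hexp : HasDerivAt (fun s => Real.exp (K * (s - a)))
        (Real.exp (K * (τ - a)) * (K * 1)) τ :=
      (((hasDerivAt_id τ).sub_const a).const_mul K).exp
    have hdτ : HasDerivAt d (v * Real.exp (K * (τ - a)) + K * d τ) τ := by
      have hprod := hv.mul hexp
      simp only [Real.exp_neg] at hprod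
      refine (hprod.congr_of_eventuallyEq (.of_forall fun s => ?_)).congr_deriv ?_
      · simp [Real.exp_ne_zero]
      · field_simp
    have := hτ _ hdτ
    exact nonpos_of_mul_nonpos_left (by linarith) (Real.exp_pos (K * (τ - a)))
  rwa [Real.exp_neg, ← div_eq_mul_inv, div_le_iff₀ (Real.exp_pos _)] at hweighted

end OneSidedLipschitz

section AbsolutelyContinuous

variable {a b : ℝ}

theorem sub_le_mul_of_ae_hasDerivAt_le {φ : ℝ → ℝ} {L : ℝ} (hab : a ≤ b)
    (hφ : AbsolutelyContinuousOnInterval φ a b)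
    (hd : ∀ᵐ t ∂(volume.restrict (Icc a b)), ∃ v, HasDerivAt φ v t ∧ v ≤ L) :
    φ b - φ a ≤ L * (b - a) := by
  calc φ b - φ a = ∫ t in a..b, deriv φ t := hφ.integral_deriv_eq_sub.symm
    _ ≤ ∫ _ in a..b, L := by
        refine intervalIntegral.integral_mono_ae_restrict hab hφ.intervalIntegrable_deriv
          intervalIntegrable_const ?_
        filter_upwards [hd] with t ⟨v, hv, hvL⟩
        exact hv.deriv.trans_le hvL
    _ = L * (b - a) := by rw [intervalIntegral.integral_const, smul_eq_mul, mul_comm]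

theorem absolutelyContinuousOnInterval_comp_of_lipschitzWith {X Z : Type*} [PseudoMetricSpace X]
    [PseudoMetricSpace Z] {φ : X → Z} {K : ℝ≥0} (hφ : LipschitzWith K φ) {x : ℝ → X}
    (hx : AbsolutelyContinuousOnInterval x a b) :
    AbsolutelyContinuousOnInterval (φ ∘ x) a b := by
  refine squeeze_zero (fun E => Finset.sum_nonneg fun _ _ => dist_nonneg) (fun E => ?_)
    (by simpa using Tendsto.const_mul (K : ℝ) hx)
  rw [Finset.mul_sum]
  exact Finset.sum_le_sum fun _ _ => hφ.dist_le_mul _ _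

end AbsolutelyContinuous

section UniformLipschitz

variable {E P F : Type*} [PseudoMetricSpace E] [TopologicalSpace P] [PseudoMetricSpace F]
  {f : E → P → F} {W : Set P}

theorem exists_lipschitzOnWith_nhds_of_isCompact (hW : IsCompact W) {x₀ : E}
    (hloc : ∀ w₀ ∈ W, ∃ K : ℝ≥0, ∃ A ∈ 𝓝 x₀, ∃ B ∈ 𝓝 w₀,
      ∀ w ∈ B, LipschitzOnWith K (fun x => f x w) A) :
    ∃ K : ℝ≥0, ∃ A ∈ 𝓝 x₀, ∀ w ∈ W, LipschitzOnWith K (fun x => f x w) A := by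
  refine hW.induction_on
    (p := fun S => ∃ K : ℝ≥0, ∃ A ∈ 𝓝 x₀, ∀ w ∈ S, LipschitzOnWith K (fun x => f x w) A)
    ⟨0, univ, univ_mem, by simp⟩ ?_ ?_ ?_
  · rintro S S' hSS' ⟨K, A, hA, h⟩
    exact ⟨K, A, hA, fun w hw => h w (hSS' hw)⟩
  · rintro S S' ⟨K, A, hA, h⟩ ⟨K', A', hA', h'⟩
    refine ⟨max K K', A ∩ A', inter_mem hA hA', ?_⟩
    rintro w (hw | hw)
    · exact ((h w hw).mono inter_subset_left).weaken (le_max_left _ _)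
    · exact ((h' w hw).mono inter_subset_right).weaken (le_max_right _ _)
  · intro w₀ hw₀
    obtain ⟨K, A, hA, B, hB, h⟩ := hloc w₀ hw₀
    exact ⟨B, mem_nhdsWithin_of_mem_nhds hB, K, A, hA, h⟩

/-- Currying `f` to a map into `C(W, F)` turns uniformity in the parameter into the fact that a
locally Lipschitz map is Lipschitz on compact sets. -/
theorem exists_lipschitzOnWith_of_isCompact (hW : IsCompact W) (hf : ∀ x, Continuous (f x))
    (hloc : ∀ x₀, ∀ w₀ ∈ W, ∃ K : ℝ≥0, ∃ A ∈ 𝓝 x₀, ∃ B ∈ 𝓝 w₀,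
      ∀ w ∈ B, LipschitzOnWith K (fun x => f x w) A) {B : Set E} (hB : IsCompact B) :
    ∃ K : ℝ≥0, ∀ w ∈ W, LipschitzOnWith K (fun x => f x w) B := by
  have : CompactSpace W := isCompact_iff_compactSpace.1 hW
  let fW : E → C(W, F) := fun x => ⟨fun w => f x w, (hf x).comp continuous_subtype_val⟩
  have hfW : LocallyLipschitz fW := by
    intro x₀
    obtain ⟨K, A, hA, h⟩ := exists_lipschitzOnWith_nhds_of_isCompact hW (hloc x₀)
    refine ⟨K, A, hA, LipschitzOnWith.of_dist_le_mul fun x hx y hy => ?_⟩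
    exact (ContinuousMap.dist_le (by positivity)).2 fun w => (h w w.2).dist_le_mul x hx y hy
  obtain ⟨K, hK⟩ := hfW.locallyLipschitzOn.exists_lipschitzOnWith_of_compact hB
  refine ⟨K, fun w hw => LipschitzOnWith.of_dist_le_mul fun x hx y hy => ?_⟩
  exact (ContinuousMap.dist_apply_le_dist (f := fW x) (g := fW y) ⟨w, hw⟩).trans
    (hK.dist_le_mul x hx y hy)

end UniformLipschitz

theorem isClosed_setOf_exists_mem_of_isCompact {X P : Type*} [TopologicalSpace X]
    [TopologicalSpace P] {Q : Set P} (hQ : IsCompact Q) {S : Set (X × P)} (hS : IsClosed S) :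
    IsClosed {x | ∃ p ∈ Q, (x, p) ∈ S} := by
  have : CompactSpace Q := isCompact_iff_compactSpace.1 hQ
  have hproj := isClosedMap_fst_of_compactSpace (X := X) (Y := Q) _
    (hS.preimage (f := fun z : X × Q => (z.1, (z.2 : P))) (by fun_prop))
  convert hproj using 1
  ext x
  simp

/-- The index of the first near-minimizer along a dense sequence is a measurable function of the
parameter; the margin `ε` makes such an index exist. -/
theorem exists_measurable_forall_le_add {X A : Type*} [MeasurableSpace X] [TopologicalSpace A]
    [TopologicalSpace.SeparableSpace A] [Nonempty A] [MeasurableSpace A] {Φ : A → X → ℝ}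
    (hmeas : ∀ u, Measurable (Φ u)) (husc : ∀ x, UpperSemicontinuous fun u => Φ u x)
    (hbdd : ∀ x, BddBelow (range fun u => Φ u x)) {ε : X → ℝ} (hε : Measurable ε) :
    ∃ μ : X → A, Measurable μ ∧ ∀ x, 0 < ε x → ∀ u, Φ (μ x) x ≤ Φ u x + ε x := by
  classical
  obtain ⟨u, hu⟩ := TopologicalSpace.exists_dense_seq A
  let nearMin : X → ℕ → Prop := fun x k => ε x ≤ 0 ∨ ∀ j, Φ (u k) x ≤ Φ (u j) x + ε x
  have hex : ∀ x, ∃ k, nearMin x k := by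
    intro x
    by_cases hx : ε x ≤ 0
    · exact ⟨0, .inl hx⟩
    have hbddu : BddBelow (range fun k => Φ (u k) x) :=
      (hbdd x).mono (range_comp_subset_range u fun v => Φ v x)
    obtain ⟨k, hk⟩ := exists_lt_of_ciInf_lt (lt_add_of_pos_right (⨅ j, Φ (u j) x) (not_le.1 hx))
    exact ⟨k, .inr fun j => hk.le.trans (by gcongr; exact ciInf_le hbddu j)⟩
  have hnearMin : ∀ k, MeasurableSet {x | nearMin x k} := fun k => by
    have hunion : {x | nearMin x k} =
        {x | ε x ≤ 0} ∪ ⋂ j, {x | Φ (u k) x ≤ Φ (u j) x + ε x} := by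
      ext x
      simp [nearMin]
    rw [hunion]
    exact (measurableSet_le hε measurable_const).union
      (.iInter fun j => measurableSet_le (hmeas _) ((hmeas _).add hε))
  refine ⟨fun x => u (Nat.find (hex x)), measurable_from_nat.comp (measurable_find hex hnearMin),
    fun x hx v => ?_⟩
  have hfind := (Nat.find_spec (hex x)).resolve_left (not_le.2 hx)
  refine hu.induction_on (p := fun v => Φ (u (Nat.find (hex x))) x ≤ Φ v x + ε x) v ?_ hfind
  simp only [← sub_le_iff_le_add]
  exact upperSemicontinuous_iff_isClosed_preimage.1 (husc x) _

theorem locallyIntegrable_of_measurable_of_mem {X E : Type*} [TopologicalSpace X]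
    [MeasurableSpace X] {m : Measure X} [IsLocallyFiniteMeasure m] [NormedAddCommGroup E]
    [MeasurableSpace E] [OpensMeasurableSpace E] [SecondCountableTopology E] {φ : X → E} {S : Set E}
    (hφ : Measurable φ) (hS : Bornology.IsBounded S) (hφS : ∀ p, φ p ∈ S) :
    LocallyIntegrable φ m := by
  obtain ⟨C, hC⟩ := hS.exists_norm_le
  exact (locallyIntegrable_const C).mono hφ.aestronglyMeasurable
    (ae_of_all _ fun p => (hC _ (hφS p)).trans (Real.le_norm_self C))

section ConvexBody

variable {E : Type*} [NormedAddCommGroup E] [InnerProductSpace ℝ E] {Z : Set E} {x q : E}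

/-- Nonempty compact convex sets, in unbundled form so that a tube can be a function into `Set E`
whose values are convex bodies only on a time interval. -/
structure IsConvexBody (Z : Set E) : Prop where
  nonempty : Z.Nonempty
  isCompact : IsCompact Z
  convex : Convex ℝ Z

/-- The metric projection of `x` onto the convex set `Z`, characterised by the variational
inequality; an arbitrary vector if there is no such point. -/
noncomputable def nearestPoint (Z : Set E) (x : E) : E :=
  Classical.epsilon fun q => q ∈ Z ∧ ∀ y ∈ Z, ⟪x - q, y - q⟫_ℝ ≤ 0

/-- The vector from the nearest point of `Z` to `x`. Its length is the distance from `x` to `Z`,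
and its direction is the one in which the tube is separated from a state outside it. -/
noncomputable def outwardNormal (Z : Set E) (x : E) : E :=
  x - nearestPoint Z x

theorem IsConvexBody.nearestPoint_spec (hZ : IsConvexBody Z) (x : E) :
    nearestPoint Z x ∈ Z ∧ ∀ y ∈ Z, ⟪outwardNormal Z x, y - nearestPoint Z x⟫_ℝ ≤ 0 := by
  refine Classical.epsilon_spec (p := fun q => q ∈ Z ∧ ∀ y ∈ Z, ⟪x - q, y - q⟫_ℝ ≤ 0) ?_
  obtain ⟨q, hq, hmin⟩ :=
    exists_norm_eq_iInf_of_complete_convex hZ.nonempty hZ.isCompact.isComplete hZ.convex x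
  exact ⟨q, hq, (norm_eq_iInf_iff_real_inner_le_zero hZ.convex hq).1 hmin⟩

theorem IsConvexBody.nearestPoint_mem (hZ : IsConvexBody Z) (x : E) : nearestPoint Z x ∈ Z :=
  (hZ.nearestPoint_spec x).1

theorem IsConvexBody.eq_nearestPoint (hZ : IsConvexBody Z) (hq : q ∈ Z)
    (hvar : ∀ y ∈ Z, ⟪x - q, y - q⟫_ℝ ≤ 0) : q = nearestPoint Z x := by
  have hq' := hvar _ (hZ.nearestPoint_mem x)
  have hp := (hZ.nearestPoint_spec x).2 q hq
  have hsum : ⟪q - nearestPoint Z x, q - nearestPoint Z x⟫_ℝ =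
      ⟪x - q, nearestPoint Z x - q⟫_ℝ + ⟪outwardNormal Z x, q - nearestPoint Z x⟫_ℝ := by
    simp only [outwardNormal, inner_sub_left, inner_sub_right]
    ring
  exact sub_eq_zero.1 (real_inner_self_nonpos.1 (by linarith))

theorem IsConvexBody.outwardNormal_eq_zero_iff (hZ : IsConvexBody Z) :
    outwardNormal Z x = 0 ↔ x ∈ Z := by
  refine ⟨fun h => ?_, fun h => sub_eq_zero.2 (hZ.eq_nearestPoint h (by simp))⟩
  rw [sub_eq_zero.1 h]
  exact hZ.nearestPoint_mem x

end ConvexBody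

section SupportFn

variable {n : ℕ} {Z : Set (Eu n)} {c : Eu n}

theorem inner_le_supportFn (hZ : IsCompact Z) {z : Eu n} (hz : z ∈ Z) :
    ⟪c, z⟫_ℝ ≤ supportFn Z c :=
  le_csSup (hZ.image (by fun_prop)).bddAbove (mem_image_of_mem _ hz)

theorem supportFn_le (hne : Z.Nonempty) {r : ℝ} (h : ∀ z ∈ Z, ⟪c, z⟫_ℝ ≤ r) :
    supportFn Z c ≤ r :=
  csSup_le (hne.image _) (forall_mem_image.2 h)

theorem exists_inner_eq_supportFn (hZ : IsCompact Z) (hne : Z.Nonempty) (c : Eu n) :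
    ∃ z ∈ Z, ⟪c, z⟫_ℝ = supportFn Z c :=
  (hZ.image (f := fun z : Eu n => ⟪c, z⟫_ℝ) (by fun_prop)).sSup_mem (hne.image _)

theorem lipschitzWith_supportFn (hZ : IsCompact Z) (hne : Z.Nonempty) {R : ℝ≥0}
    (hR : ∀ z ∈ Z, ‖z‖ ≤ R) : LipschitzWith R (supportFn Z) := by
  refine LipschitzWith.of_le_add_mul R fun c c' => supportFn_le hne fun z hz => ?_
  calc ⟪c, z⟫_ℝ = ⟪c', z⟫_ℝ + ⟪c - c', z⟫_ℝ := by rw [inner_sub_left]; ring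
    _ ≤ supportFn Z c' + ‖c - c'‖ * ‖z‖ :=
        add_le_add (inner_le_supportFn hZ hz) (real_inner_le_norm _ _)
    _ ≤ supportFn Z c' + R * dist c c' := by
        rw [dist_eq_norm, mul_comm (R : ℝ)]
        gcongr
        exact hR z hz

variable {x q : Eu n}

theorem IsConvexBody.supportFn_outwardNormal (hZ : IsConvexBody Z) (x : Eu n) :
    supportFn Z (outwardNormal Z x) = ⟪outwardNormal Z x, nearestPoint Z x⟫_ℝ := by
  refine le_antisymm (supportFn_le hZ.nonempty fun y hy => ?_)
    (inner_le_supportFn hZ.isCompact (hZ.nearestPoint_mem x))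
  have hvar := (hZ.nearestPoint_spec x).2 y hy
  rwa [inner_sub_right, sub_nonpos] at hvar

theorem IsConvexBody.eq_nearestPoint_iff (hZ : IsConvexBody Z) :
    q = nearestPoint Z x ↔ q ∈ Z ∧ supportFn Z (x - q) ≤ ⟪x - q, q⟫_ℝ := by
  constructor
  · rintro rfl
    exact ⟨hZ.nearestPoint_mem x, (hZ.supportFn_outwardNormal x).le⟩
  · rintro ⟨hq, hsupp⟩
    refine hZ.eq_nearestPoint hq fun y hy => ?_
    rw [inner_sub_right, sub_nonpos]
    exact (inner_le_supportFn hZ.isCompact hy).trans hsupp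

theorem IsConvexBody.inner_sub_supportFn_outwardNormal (hZ : IsConvexBody Z) (x : Eu n) :
    ⟪outwardNormal Z x, x⟫_ℝ - supportFn Z (outwardNormal Z x) =
      ‖outwardNormal Z x‖ * ‖outwardNormal Z x‖ := by
  rw [hZ.supportFn_outwardNormal, ← inner_sub_right, ← real_inner_self_eq_norm_mul_norm]
  rfl

theorem IsConvexBody.inner_sub_supportFn_le (hZ : IsConvexBody Z) (c x : Eu n) :
    ⟪c, x⟫_ℝ - supportFn Z c ≤ ‖c‖ * ‖outwardNormal Z x‖ :=
  calc ⟪c, x⟫_ℝ - supportFn Z c ≤ ⟪c, x⟫_ℝ - ⟪c, nearestPoint Z x⟫_ℝ :=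
        sub_le_sub_left (inner_le_supportFn hZ.isCompact (hZ.nearestPoint_mem x)) _
    _ = ⟪c, outwardNormal Z x⟫_ℝ := (inner_sub_right _ _ _).symm
    _ ≤ ‖c‖ * ‖outwardNormal Z x‖ := real_inner_le_norm _ _

theorem IsConvexBody.mem_iff_forall_inner_le_supportFn (hZ : IsConvexBody Z) :
    x ∈ Z ↔ ∀ c, ⟪c, x⟫_ℝ ≤ supportFn Z c := by
  refine ⟨fun hx c => inner_le_supportFn hZ.isCompact hx, fun h => ?_⟩
  rw [← hZ.outwardNormal_eq_zero_iff, ← norm_eq_zero, ← mul_self_eq_zero]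
  refine le_antisymm ?_ (mul_self_nonneg _)
  rw [← hZ.inner_sub_supportFn_outwardNormal]
  exact sub_nonpos.2 (h _)

end SupportFn

section ControlAffine

variable {nx nu nw : ℕ} {f : Eu nx → Eu nw → Eu nx} {G : Eu nx → (Eu nu →L[ℝ] Eu nx)}
  {U : Set (Eu nu)} {W : Set (Eu nw)} {B Z : Set (Eu nx)}

theorem continuous_rhs (hf : Continuous fun p : Eu nx × Eu nw => f p.1 p.2) (hG : Continuous G) :
    Continuous fun p : Eu nx × Eu nu × Eu nw => rhs f G p.1 p.2.1 p.2.2 := by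
  have hfp : Continuous fun p : Eu nx × Eu nu × Eu nw => f p.1 p.2.2 :=
    hf.comp (f := fun p : Eu nx × Eu nu × Eu nw => (p.1, p.2.2)) (by fun_prop)
  exact hfp.add ((hG.comp continuous_fst).clm_apply (by fun_prop))

theorem exists_lipschitzOnWith_rhs (hf : Continuous fun p : Eu nx × Eu nw => f p.1 p.2)
    (hfLip : LocLipschitzInState f) (hG : LocallyLipschitz G) (hU : Bornology.IsBounded U)
    (hW : IsCompact W) (hB : IsCompact B) :
    ∃ K : ℝ≥0, ∀ ν ∈ U, ∀ ω ∈ W, LipschitzOnWith K (fun x => rhs f G x ν ω) B := by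
  obtain ⟨Kf, hKf⟩ := exists_lipschitzOnWith_of_isCompact hW (fun x => hf.comp (.prodMk_right x))
    (fun x₀ w₀ _ => hfLip x₀ w₀) hB
  obtain ⟨KG, hKG⟩ := hG.locallyLipschitzOn.exists_lipschitzOnWith_of_compact hB
  obtain ⟨C, -, hC⟩ := hU.exists_pos_norm_le
  refine ⟨Kf + KG * C.toNNReal, fun ν hν ω hω => (hKf ω hω).add ?_⟩
  refine LipschitzOnWith.of_dist_le_mul fun x hx y hy => ?_
  calc dist (G x ν) (G y ν) = ‖(G x - G y) ν‖ := by rw [dist_eq_norm, sub_apply]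
    _ ≤ ‖G x - G y‖ * ‖ν‖ := (G x - G y).le_opNorm ν
    _ ≤ (KG * dist x y) * C.toNNReal := by
        rw [← dist_eq_norm]
        gcongr
        · exact hKG.dist_le_mul x hx y hy
        · exact (hC ν hν).trans (Real.le_coe_toNNReal C)
    _ = ↑(KG * C.toNNReal) * dist x y := by push_cast; ring

theorem gam_eq_image (ν : Eu nu) (c : Eu nx) (Z : Set (Eu nx)) :
    Gam f G W ν c Z = (fun p : Eu nx × Eu nw => rhs f G p.1 ν p.2) ''
      ((Z ∩ {ξ | ⟪c, ξ⟫_ℝ = supportFn Z c}) ×ˢ W) := by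
  ext y
  constructor
  · rintro ⟨ξ, ω, hc, hξ, hω, rfl⟩
    exact ⟨(ξ, ω), ⟨⟨hξ, hc⟩, hω⟩, rfl⟩
  · rintro ⟨⟨ξ, ω⟩, ⟨⟨hξ, hc⟩, hω⟩, rfl⟩
    exact ⟨ξ, ω, hc, hξ, hω, rfl⟩

theorem gam_nonempty (hW : W.Nonempty) (hZ : IsCompact Z) (hne : Z.Nonempty) (ν : Eu nu)
    (c : Eu nx) : (Gam f G W ν c Z).Nonempty := by
  obtain ⟨ξ, hξ, hc⟩ := exists_inner_eq_supportFn hZ hne c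
  obtain ⟨ω, hω⟩ := hW
  exact ⟨_, ξ, ω, hc, hξ, hω, rfl⟩

variable (hg : Continuous fun p : Eu nx × Eu nu × Eu nw => rhs f G p.1 p.2.1 p.2.2)
include hg

theorem exists_norm_rhs_le (hU : IsCompact U) (hW : IsCompact W) (hB : IsCompact B) :
    ∃ M : ℝ≥0, ∀ ξ ∈ B, ∀ ν ∈ U, ∀ ω ∈ W, ‖rhs f G ξ ν ω‖ ≤ M := by
  obtain ⟨M, hM⟩ := (hB.prod (hU.prod hW)).exists_bound_of_continuousOn hg.continuousOn
  exact ⟨M.toNNReal, fun ξ hξ ν hν ω hω =>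
    (hM (ξ, ν, ω) ⟨hξ, hν, hω⟩).trans (Real.le_coe_toNNReal M)⟩

theorem isCompact_gam (hW : IsCompact W) (hZ : IsCompact Z) (ν : Eu nu) (c : Eu nx) :
    IsCompact (Gam f G W ν c Z) := by
  rw [gam_eq_image]
  refine ((hZ.inter_right (isClosed_eq (by fun_prop) continuous_const)).prod hW).image ?_
  exact hg.comp (f := fun p : Eu nx × Eu nw => (p.1, ν, p.2)) (by fun_prop)

theorem inner_rhs_le_supportFn_gam (hW : IsCompact W) (hZ : IsCompact Z) {ν : Eu nu} {c ξ : Eu nx}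
    {ω : Eu nw} (hξ : ξ ∈ Z) (hc : supportFn Z c ≤ ⟪c, ξ⟫_ℝ) (hω : ω ∈ W) :
    ⟪c, rhs f G ξ ν ω⟫_ℝ ≤ supportFn (Gam f G W ν c Z) c :=
  inner_le_supportFn (isCompact_gam hg hW hZ ν c)
    ⟨ξ, ω, (inner_le_supportFn hZ hξ).antisymm hc, hξ, hω, rfl⟩

theorem le_supportFn_gam_iff (hW : IsCompact W) (hWne : W.Nonempty) (hZ : IsCompact Z)
    (hne : Z.Nonempty) {ν : Eu nu} {c : Eu nx} {r : ℝ} :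
    r ≤ supportFn (Gam f G W ν c Z) c ↔
      ∃ ξ ∈ Z, ∃ ω ∈ W, supportFn Z c ≤ ⟪c, ξ⟫_ℝ ∧ r ≤ ⟪c, rhs f G ξ ν ω⟫_ℝ := by
  constructor
  · intro hr
    obtain ⟨_, ⟨ξ, ω, hc, hξ, hω, rfl⟩, hy⟩ := exists_inner_eq_supportFn
      (isCompact_gam hg hW hZ ν c) (gam_nonempty hWne hZ hne ν c) c
    exact ⟨ξ, hξ, ω, hω, hc.ge, hr.trans hy.ge⟩
  · rintro ⟨ξ, hξ, ω, hω, hc, hr⟩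
    exact hr.trans (inner_rhs_le_supportFn_gam hg hW hZ hξ hc hω)

theorem neg_mul_le_supportFn_gam (hW : IsCompact W) (hWne : W.Nonempty) (hZ : IsCompact Z)
    (hne : Z.Nonempty) {M : ℝ} {ν : Eu nu} (hM : ∀ ξ ∈ Z, ∀ ω ∈ W, ‖rhs f G ξ ν ω‖ ≤ M)
    (c : Eu nx) : -(M * ‖c‖) ≤ supportFn (Gam f G W ν c Z) c := by
  obtain ⟨ξ, hξ, hc⟩ := exists_inner_eq_supportFn hZ hne c
  obtain ⟨ω, hω⟩ := hWne
  calc -(M * ‖c‖) ≤ -(‖c‖ * ‖rhs f G ξ ν ω‖) := by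
        rw [mul_comm M]
        gcongr
        exact hM ξ hξ ω hω
    _ ≤ ⟪c, rhs f G ξ ν ω⟫_ℝ := neg_le_of_abs_le (abs_real_inner_le_norm _ _)
    _ ≤ supportFn (Gam f G W ν c Z) c := inner_rhs_le_supportFn_gam hg hW hZ hξ hc.ge hω

theorem neg_mul_le_minMax (hU : U.Nonempty) (hW : IsCompact W) (hWne : W.Nonempty)
    (hZ : IsCompact Z) (hne : Z.Nonempty) {M : ℝ}
    (hM : ∀ ξ ∈ Z, ∀ ν ∈ U, ∀ ω ∈ W, ‖rhs f G ξ ν ω‖ ≤ M) (c : Eu nx) :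
    -(M * ‖c‖) ≤ minMax f G U W c Z :=
  le_csInf (hU.image _) <| forall_mem_image.2 fun ν hν =>
    neg_mul_le_supportFn_gam hg hW hWne hZ hne (fun ξ hξ ω hω => hM ξ hξ ν hν ω hω) c

end ControlAffine

section Tube

variable {T : Type*} [TopologicalSpace T] {n : ℕ} {Y : T → Set (Eu n)}

theorem isClosed_setOf_mem_tube (hY : ∀ t, IsConvexBody (Y t))
    (hV : ∀ c, Continuous fun t => supportFn (Y t) c) :
    IsClosed {p : T × Eu n | p.2 ∈ Y p.1} := by
  have hinter : {p : T × Eu n | p.2 ∈ Y p.1} =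
      ⋂ c : Eu n, {p | ⟪c, p.2⟫_ℝ ≤ supportFn (Y p.1) c} := by
    ext p
    simp only [mem_ofPred_eq, mem_iInter]
    exact (hY p.1).mem_iff_forall_inner_le_supportFn
  rw [hinter]
  exact isClosed_iInter fun c => isClosed_le (by fun_prop) ((hV c).comp continuous_fst)

variable [CompactSpace T]

theorem exists_forall_norm_le_of_continuous_supportFn (hY : ∀ t, IsCompact (Y t))
    (hV : ∀ c, Continuous fun t => supportFn (Y t) c) :
    ∃ R : ℝ≥0, ∀ t, ∀ z ∈ Y t, ‖z‖ ≤ R := by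
  let e := EuclideanSpace.basisFun (Fin n) ℝ
  choose C hC using fun c => (isCompact_range (hV c)).bddAbove
  have hz : ∀ c t, ∀ z ∈ Y t, ⟪c, z⟫_ℝ ≤ C c := fun c t z hz =>
    (inner_le_supportFn (hY t) hz).trans (hC c (mem_range_self t))
  refine ⟨(∑ i, max (C (e i)) (C (-(e i)))).toNNReal, fun t z hzt => ?_⟩
  refine le_trans ?_ (Real.le_coe_toNNReal _)
  calc ‖z‖ = ‖∑ i, ⟪e i, z⟫_ℝ • e i‖ := by rw [e.sum_repr' z]
    _ ≤ ∑ i, ‖⟪e i, z⟫_ℝ • e i‖ := norm_sum_le _ _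
    _ ≤ ∑ i, max (C (e i)) (C (-(e i))) := by
      refine Finset.sum_le_sum fun i _ => ?_
      rw [norm_smul, e.norm_eq_one, mul_one, Real.norm_eq_abs]
      refine abs_le'.2 ⟨(hz _ t z hzt).trans (le_max_left _ _), ?_⟩
      rw [← inner_neg_left]
      exact (hz _ t z hzt).trans (le_max_right _ _)

theorem continuous_supportFn_uncurry (hY : ∀ t, IsConvexBody (Y t))
    (hV : ∀ c, Continuous fun t => supportFn (Y t) c) :
    Continuous fun p : T × Eu n => supportFn (Y p.1) p.2 := by
  obtain ⟨R, hR⟩ := exists_forall_norm_le_of_continuous_supportFn (fun t => (hY t).isCompact) hV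
  exact continuous_prod_of_continuous_lipschitzWith' _ R
    (fun t => lipschitzWith_supportFn (hY t).isCompact (hY t).nonempty (hR t)) hV

theorem continuous_nearestPoint_uncurry (hY : ∀ t, IsConvexBody (Y t))
    (hV : ∀ c, Continuous fun t => supportFn (Y t) c) :
    Continuous fun p : T × Eu n => nearestPoint (Y p.1) p.2 := by
  obtain ⟨R, hR⟩ := exists_forall_norm_le_of_continuous_supportFn (fun t => (hY t).isCompact) hV
  rw [continuous_iff_isClosed]
  intro C hC
  have hgraph : IsClosed {z : (T × Eu n) × Eu n | z.2 ∈ C ∧ z.2 ∈ Y z.1.1 ∧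
      supportFn (Y z.1.1) (z.1.2 - z.2) ≤ ⟪z.1.2 - z.2, z.2⟫_ℝ} := by
    refine (hC.preimage continuous_snd).inter (IsClosed.inter ?_ ?_)
    · exact (isClosed_setOf_mem_tube hY hV).preimage
        (f := fun z : (T × Eu n) × Eu n => (z.1.1, z.2)) (by fun_prop)
    · exact isClosed_le ((continuous_supportFn_uncurry hY hV).comp
        (f := fun z : (T × Eu n) × Eu n => (z.1.1, z.1.2 - z.2)) (by fun_prop)) (by fun_prop)
  convert isClosed_setOf_exists_mem_of_isCompact
    (isCompact_closedBall (0 : Eu n) R) hgraph using 1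
  ext ⟨t, x⟩
  constructor
  · intro hx
    exact ⟨nearestPoint (Y t) x, by simpa using hR t _ ((hY t).nearestPoint_mem x), hx,
      (hY t).eq_nearestPoint_iff.1 rfl⟩
  · rintro ⟨q, -, hqC, hq⟩
    have hqx : q = nearestPoint (Y t) x := (hY t).eq_nearestPoint_iff.2 hq
    simpa only [mem_preimage, ← hqx] using hqC

theorem continuous_outwardNormal_uncurry (hY : ∀ t, IsConvexBody (Y t))
    (hV : ∀ c, Continuous fun t => supportFn (Y t) c) :
    Continuous fun p : T × Eu n => outwardNormal (Y p.1) p.2 :=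
  continuous_snd.sub (continuous_nearestPoint_uncurry hY hV)

end Tube

section Feedback

variable {T : Type*} [TopologicalSpace T] [CompactSpace T] {nx nu nw : ℕ}
  {f : Eu nx → Eu nw → Eu nx} {G : Eu nx → (Eu nu →L[ℝ] Eu nx)} {U : Set (Eu nu)}
  {W : Set (Eu nw)} {Y : T → Set (Eu nx)}

theorem upperSemicontinuous_supportFn_gam
    (hg : Continuous fun p : Eu nx × Eu nu × Eu nw => rhs f G p.1 p.2.1 p.2.2)
    (hW : IsCompact W) (hWne : W.Nonempty) (hY : ∀ t, IsConvexBody (Y t))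
    (hV : ∀ c, Continuous fun t => supportFn (Y t) c) :
    UpperSemicontinuous fun p : T × Eu nx × Eu nu =>
      supportFn (Gam f G W p.2.2 p.2.1 (Y p.1)) p.2.1 := by
  obtain ⟨R, hR⟩ := exists_forall_norm_le_of_continuous_supportFn (fun t => (hY t).isCompact) hV
  refine upperSemicontinuous_iff_isClosed_preimage.2 fun r => ?_
  have hS : IsClosed {z : (T × Eu nx × Eu nu) × (Eu nx × Eu nw) | z.2.1 ∈ Y z.1.1 ∧
      supportFn (Y z.1.1) z.1.2.1 ≤ ⟪z.1.2.1, z.2.1⟫_ℝ ∧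
      r ≤ ⟪z.1.2.1, rhs f G z.2.1 z.1.2.2 z.2.2⟫_ℝ} := by
    refine IsClosed.inter ?_ (IsClosed.inter ?_ ?_)
    · exact (isClosed_setOf_mem_tube hY hV).preimage
        (f := fun z : (T × Eu nx × Eu nu) × (Eu nx × Eu nw) => (z.1.1, z.2.1)) (by fun_prop)
    · exact isClosed_le ((continuous_supportFn_uncurry hY hV).comp
        (f := fun z : (T × Eu nx × Eu nu) × (Eu nx × Eu nw) => (z.1.1, z.1.2.1)) (by fun_prop))
        (by fun_prop)
    · refine isClosed_le continuous_const (Continuous.inner (𝕜 := ℝ) (by fun_prop) ?_)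
      exact hg.comp (f := fun z : (T × Eu nx × Eu nu) × (Eu nx × Eu nw) =>
        (z.2.1, z.1.2.2, z.2.2)) (by fun_prop)
  convert isClosed_setOf_exists_mem_of_isCompact
    ((isCompact_closedBall (0 : Eu nx) R).prod hW) hS using 1
  ext ⟨t, c, ν⟩
  simp only [mem_preimage, mem_Ici, mem_ofPred_eq]
  rw [le_supportFn_gam_iff hg hW hWne (hY t).isCompact (hY t).nonempty]
  constructor
  · rintro ⟨ξ, hξ, ω, hω, hc, hr⟩
    exact ⟨(ξ, ω), ⟨by simpa using hR t ξ hξ, hω⟩, hξ, hc, hr⟩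
  · rintro ⟨⟨ξ, ω⟩, ⟨-, hω⟩, hξ, hc, hr⟩
    exact ⟨ξ, hξ, ω, hω, hc, hr⟩

/-- The control `ν` minimises, up to a margin, the worst-case velocity of the support points of `Z`
in the direction pointing from `Z` to `x`. The margin `‖outwardNormal Z x‖ ^ 2` only increases the
Grönwall constant by one, and it is what makes a measurable choice of `ν` elementary. -/
def IsNearMinimizing (f : Eu nx → Eu nw → Eu nx) (G : Eu nx → (Eu nu →L[ℝ] Eu nx))
    (U : Set (Eu nu)) (W : Set (Eu nw)) (Z : Set (Eu nx)) (x : Eu nx) (ν : Eu nu) : Prop :=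
  supportFn (Gam f G W ν (outwardNormal Z x) Z) (outwardNormal Z x) ≤
    minMax f G U W (outwardNormal Z x) Z + ‖outwardNormal Z x‖ ^ 2

theorem exists_measurable_isNearMinimizing [MeasurableSpace T] [OpensMeasurableSpace T]
    (hg : Continuous fun p : Eu nx × Eu nu × Eu nw => rhs f G p.1 p.2.1 p.2.2)
    (hU : IsCompact U) (hUne : U.Nonempty) (hW : IsCompact W) (hWne : W.Nonempty)
    (hY : ∀ t, IsConvexBody (Y t)) (hV : ∀ c, Continuous fun t => supportFn (Y t) c) :
    ∃ μ : T × Eu nx → U, Measurable μ ∧ ∀ t x, outwardNormal (Y t) x ≠ 0 →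
      IsNearMinimizing f G U W (Y t) x (μ (t, x)) := by
  have : Nonempty U := hUne.to_subtype
  have hN : Continuous fun p : T × Eu nx => outwardNormal (Y p.1) p.2 :=
    continuous_outwardNormal_uncurry hY hV
  have husc := upperSemicontinuous_supportFn_gam hg hW hWne hY hV
  let Φ : U → T × Eu nx → ℝ := fun ν p =>
    supportFn (Gam f G W ν (outwardNormal (Y p.1) p.2) (Y p.1)) (outwardNormal (Y p.1) p.2)
  have hmeas : ∀ ν, Measurable (Φ ν) := fun ν =>
    (husc.comp (g := fun p : T × Eu nx => (p.1, outwardNormal (Y p.1) p.2, (ν : Eu nu)))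
      (by fun_prop)).measurable
  have huscν : ∀ p, UpperSemicontinuous fun ν => Φ ν p := fun p =>
    husc.comp (g := fun ν : U => (p.1, outwardNormal (Y p.1) p.2, (ν : Eu nu))) (by fun_prop)
  have hbdd : ∀ p, BddBelow (range fun ν => Φ ν p) := by
    rintro ⟨t, x⟩
    obtain ⟨M, hM⟩ := exists_norm_rhs_le hg hU hW (hY t).isCompact
    exact ⟨_, forall_mem_range.2 fun ν => neg_mul_le_supportFn_gam hg hW hWne (hY t).isCompact
      (hY t).nonempty (fun ξ hξ ω hω => hM ξ hξ ν ν.2 ω hω) _⟩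
  obtain ⟨μ, hμ, hmin⟩ :=
    exists_measurable_forall_le_add hmeas huscν hbdd (hN.norm.pow 2).measurable
  refine ⟨μ, hμ, fun t x hx => ?_⟩
  rw [IsNearMinimizing, ← sub_le_iff_le_add]
  refine le_csInf (hUne.image _) (forall_mem_image.2 fun ν hν => ?_)
  exact sub_le_iff_le_add.2 (hmin (t, x) (pow_pos (norm_pos_iff.2 hx) 2) ⟨ν, hν⟩)

end Feedback

section DistanceAlongCurve

variable {n : ℕ} {Y : ℝ → Set (Eu n)} {x : ℝ → Eu n} {a b t : ℝ}

theorem exists_isCompact_tube_subset_and_curve_mem (hY : ∀ t ∈ Icc a b, IsCompact (Y t))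
    (hV : ∀ c, ContinuousOn (fun t => supportFn (Y t) c) (Icc a b))
    (hx : ContinuousOn x (Icc a b)) :
    ∃ B : Set (Eu n), IsCompact B ∧ ∀ t ∈ Icc a b, Y t ⊆ B ∧ x t ∈ B := by
  obtain ⟨R, hR⟩ := exists_forall_norm_le_of_continuous_supportFn
    (Y := fun t : Icc a b => Y t) (fun t => hY t t.2) (fun c => (hV c).domRestrict)
  refine ⟨Metric.closedBall 0 R ∪ x '' Icc a b,
    (isCompact_closedBall _ _).union (isCompact_Icc.image_of_continuousOn hx),
    fun t ht => ⟨fun z hz => .inl ?_, .inr (mem_image_of_mem x ht)⟩⟩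
  exact mem_closedBall_zero_iff.2 (hR ⟨t, ht⟩ z hz)

theorem inner_sub_supportFn_sub_le {M : ℝ} {c : Eu n} (hab : a ≤ b)
    (hx : AbsolutelyContinuousOnInterval x a b)
    (hxM : ∀ᵐ t ∂(volume.restrict (Icc a b)), ∃ v, HasDerivAt x v t ∧ ‖v‖ ≤ M)
    (hV : AbsolutelyContinuousOnInterval (fun t => supportFn (Y t) c) a b)
    (hVM : ∀ᵐ t ∂(volume.restrict (Icc a b)),
      ∃ v, HasDerivAt (fun s => supportFn (Y s) c) v t ∧ -(M * ‖c‖) ≤ v) :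
    (⟪c, x b⟫_ℝ - supportFn (Y b) c) - (⟪c, x a⟫_ℝ - supportFn (Y a) c) ≤
      2 * M * ‖c‖ * (b - a) := by
  have hinner : AbsolutelyContinuousOnInterval (fun t => ⟪c, x t⟫_ℝ) a b :=
    absolutelyContinuousOnInterval_comp_of_lipschitzWith (innerSL ℝ c).lipschitz hx
  refine sub_le_mul_of_ae_hasDerivAt_le hab (hinner.fun_sub hV) ?_
  filter_upwards [hxM, hVM] with t ⟨x', hx', hx'M⟩ ⟨v, hv, hvM⟩
  refine ⟨_, (((innerSL ℝ c).hasFDerivAt.comp_hasDerivAt t hx').sub hv), ?_⟩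
  calc ⟪c, x'⟫_ℝ - v ≤ ‖c‖ * ‖x'‖ - v := by gcongr; exact real_inner_le_norm c x'
    _ ≤ ‖c‖ * M + M * ‖c‖ := by
        rw [sub_eq_add_neg]
        gcongr
        exact neg_le.1 hvM
    _ = 2 * M * ‖c‖ := by ring

theorem oneSidedLipschitzOn_norm_outwardNormal {M : ℝ≥0} (hY : ∀ t ∈ Icc a b, IsConvexBody (Y t))
    (hx : AbsolutelyContinuousOnInterval x a b)
    (hxM : ∀ᵐ t ∂(volume.restrict (Icc a b)), ∃ v, HasDerivAt x v t ∧ ‖v‖ ≤ M)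
    (hV : ∀ c, AbsolutelyContinuousOnInterval (fun t => supportFn (Y t) c) a b)
    (hVM : ∀ c, ∀ᵐ t ∂(volume.restrict (Icc a b)),
      ∃ v, HasDerivAt (fun s => supportFn (Y s) c) v t ∧ -(M * ‖c‖) ≤ v) :
    OneSidedLipschitzOn (2 * M) (fun t => ‖outwardNormal (Y t) (x t)‖) (Icc a b) := by
  intro s hs t ht hst
  rcases (norm_nonneg (outwardNormal (Y t) (x t))).eq_or_lt with hzero | hpos
  · have hbound : 0 ≤ ((2 * M : ℝ≥0) : ℝ) * (t - s) :=
      mul_nonneg (NNReal.coe_nonneg _) (sub_nonneg.2 hst)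
    beta_reduce
    rw [← hzero]
    linarith [norm_nonneg (outwardNormal (Y s) (x s))]
  have hsub : Icc s t ⊆ Icc a b := Icc_subset_Icc hs.1 ht.2
  have hsub' : uIcc s t ⊆ uIcc a b := by
    rwa [uIcc_of_le hst, uIcc_of_le (hs.1.trans hs.2)]
  have hincr := inner_sub_supportFn_sub_le (c := outwardNormal (Y t) (x t)) hst (hx.mono hsub')
    (ae_restrict_of_ae_restrict_of_subset hsub hxM) ((hV _).mono hsub')
    (ae_restrict_of_ae_restrict_of_subset hsub (hVM _))
  rw [(hY t ht).inner_sub_supportFn_outwardNormal] at hincr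
  have hlow := (hY s hs).inner_sub_supportFn_le (outwardNormal (Y t) (x t)) (x s)
  refine le_of_mul_le_mul_left ?_ hpos
  push_cast
  linarith

/-- The envelope theorem: the distance is the maximum over unit directions `c` of
`⟪c, x t⟫ - supportFn (Y t) c`, so its derivative is that of the maximising function. -/
theorem norm_outwardNormal_mul_eq_of_hasDerivAt {x' : Eu n} {v d' : ℝ}
    (hY : ∀ᶠ s in 𝓝 t, IsConvexBody (Y s)) (hx : HasDerivAt x x' t)
    (hV : HasDerivAt (fun s => supportFn (Y s) (outwardNormal (Y t) (x t))) v t)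
    (hd : HasDerivAt (fun s => ‖outwardNormal (Y s) (x s)‖) d' t) :
    ‖outwardNormal (Y t) (x t)‖ * d' = ⟪outwardNormal (Y t) (x t), x'⟫_ℝ - v := by
  let c := outwardNormal (Y t) (x t)
  let gap : ℝ → ℝ := fun s =>
    ‖c‖ * ‖outwardNormal (Y s) (x s)‖ - (⟪c, x s⟫_ℝ - supportFn (Y s) c)
  have hgap : HasDerivAt gap (‖c‖ * d' - (⟪c, x'⟫_ℝ - v)) t :=
    (hd.const_mul ‖c‖).sub (((innerSL ℝ c).hasFDerivAt.comp_hasDerivAt t hx).sub hV)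
  have hgap_zero : gap t = 0 :=
    sub_eq_zero.2 (hY.self_of_nhds.inner_sub_supportFn_outwardNormal _).symm
  have hmin : IsLocalMin gap t := by
    filter_upwards [hY] with s hs
    rw [hgap_zero]
    exact sub_nonneg.2 (hs.inner_sub_supportFn_le c (x s))
  exact sub_eq_zero.1 (hmin.hasDerivAt_eq_zero hgap)

theorem le_mul_norm_outwardNormal_of_hasDerivAt {x' : Eu n} {v d' K : ℝ}
    (hY : ∀ᶠ s in 𝓝 t, IsConvexBody (Y s)) (hx : HasDerivAt x x' t)
    (hV : HasDerivAt (fun s => supportFn (Y s) (outwardNormal (Y t) (x t))) v t)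
    (hrate : outwardNormal (Y t) (x t) ≠ 0 →
      ⟪outwardNormal (Y t) (x t), x'⟫_ℝ ≤ v + K * ‖outwardNormal (Y t) (x t)‖ ^ 2)
    (hd : HasDerivAt (fun s => ‖outwardNormal (Y s) (x s)‖) d' t) :
    d' ≤ K * ‖outwardNormal (Y t) (x t)‖ := by
  by_cases hzero : outwardNormal (Y t) (x t) = 0
  · have hmin : IsLocalMin (fun s => ‖outwardNormal (Y s) (x s)‖) t :=
      .of_forall fun s => by simp [hzero]
    rw [hmin.hasDerivAt_eq_zero hd, hzero, norm_zero, mul_zero]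
  · refine le_of_mul_le_mul_left ?_ (norm_pos_iff.2 hzero)
    rw [norm_outwardNormal_mul_eq_of_hasDerivAt hY hx hV hd]
    linarith [hrate hzero]

end DistanceAlongCurve

section Invariance

variable {nx nu nw : ℕ} {f : Eu nx → Eu nw → Eu nx} {G : Eu nx → (Eu nu →L[ℝ] Eu nx)}
  {U : Set (Eu nu)} {W : Set (Eu nw)}

theorem IsNearMinimizing.inner_outwardNormal_rhs_le {Z B : Set (Eu nx)} {x : Eu nx} {ν : Eu nu}
    {ω : Eu nw} {K : ℝ≥0} (hν : IsNearMinimizing f G U W Z x ν)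
    (hg : Continuous fun p : Eu nx × Eu nu × Eu nw => rhs f G p.1 p.2.1 p.2.2)
    (hW : IsCompact W) (hω : ω ∈ W) (hZ : IsConvexBody Z) (hZB : Z ⊆ B) (hxB : x ∈ B)
    (hK : LipschitzOnWith K (fun ξ => rhs f G ξ ν ω) B) :
    ⟪outwardNormal Z x, rhs f G x ν ω⟫_ℝ ≤
      minMax f G U W (outwardNormal Z x) Z + (K + 1) * ‖outwardNormal Z x‖ ^ 2 := by
  have hp : nearestPoint Z x ∈ Z := hZ.nearestPoint_mem x
  have hsupport : ⟪outwardNormal Z x, rhs f G (nearestPoint Z x) ν ω⟫_ℝ ≤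
      minMax f G U W (outwardNormal Z x) Z + ‖outwardNormal Z x‖ ^ 2 :=
    (inner_rhs_le_supportFn_gam hg hW hZ.isCompact hp (hZ.supportFn_outwardNormal x).le hω).trans hν
  have hvariation : ⟪outwardNormal Z x, rhs f G x ν ω - rhs f G (nearestPoint Z x) ν ω⟫_ℝ ≤
      ‖outwardNormal Z x‖ * (K * ‖outwardNormal Z x‖) :=
    (real_inner_le_norm _ _).trans (by gcongr; exact hK.norm_sub_le hxB (hZB hp))
  rw [inner_sub_right] at hvariation
  linarith

theorem mem_tube_of_isSolution {Y : ℝ → Set (Eu nx)} {a b : ℝ}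
    (hf : Continuous fun p : Eu nx × Eu nw => f p.1 p.2) (hfLip : LocLipschitzInState f)
    (hG : LocallyLipschitz G) (hU : IsCompact U) (hW : IsCompact W)
    (hY : ∀ t ∈ Icc a b, IsConvexBody (Y t))
    (hV : ∀ c, AbsolutelyContinuousOnInterval (fun t => supportFn (Y t) c) a b)
    (hDI : ∀ᵐ t ∂(volume.restrict (Icc a b)), ∀ c,
      ∃ v, HasDerivAt (fun s => supportFn (Y s) c) v t ∧ v ≥ minMax f G U W c (Y t))
    {μ : ℝ → Eu nx → Eu nu} (hμU : ∀ t ∈ Icc a b, ∀ x, μ t x ∈ U)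
    (hμ : ∀ t ∈ Icc a b, ∀ x, outwardNormal (Y t) x ≠ 0 →
      IsNearMinimizing f G U W (Y t) x (μ t x))
    {w : ℝ → Eu nw} (hw : ∀ t, w t ∈ W) {x : ℝ → Eu nx} (hx : IsSolution f G μ w a b x)
    (hxa : x a ∈ Y a) {t : ℝ} (ht : t ∈ Icc a b) : x t ∈ Y t := by
  have hIcc : uIcc a b = Icc a b := uIcc_of_le (ht.1.trans ht.2)
  have hg := continuous_rhs hf hG.continuous
  obtain ⟨B, hB, hYxB⟩ := exists_isCompact_tube_subset_and_curve_mem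
    (fun t ht => (hY t ht).isCompact) (fun c => hIcc ▸ (hV c).continuousOn)
    (hIcc ▸ hx.1.continuousOn)
  obtain ⟨M, hM⟩ := exists_norm_rhs_le hg hU hW hB
  obtain ⟨K, hK⟩ := exists_lipschitzOnWith_rhs hf hfLip hG hU.isBounded hW hB
  have honeSided := oneSidedLipschitzOn_norm_outwardNormal (M := M) hY hx.1
    (by
      filter_upwards [hx.2, ae_restrict_mem measurableSet_Icc] with t hxt ht
      exact ⟨_, hxt, hM _ (hYxB t ht).2 _ (hμU t ht _) _ (hw t)⟩) hV
    (by
      intro c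
      filter_upwards [hDI, ae_restrict_mem measurableSet_Icc] with t hDIt ht
      obtain ⟨v, hv, hvm⟩ := hDIt c
      exact ⟨v, hv, (neg_mul_le_minMax hg ⟨_, hμU t ht 0⟩ hW ⟨_, hw t⟩ (hY t ht).isCompact
        (hY t ht).nonempty (fun ξ hξ => hM ξ ((hYxB t ht).1 hξ)) c).trans hvm⟩)
  have hgronwall := honeSided.le_mul_exp_of_ae_hasDerivAt_le (K := K + 1) (by positivity)
    (fun _ _ => norm_nonneg _)
    (by
      filter_upwards [hx.2, hDI, ae_restrict_Icc_mem_Ioo a b] with t hxt hDIt htoo d' hd'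
      have ht := Ioo_subset_Icc_self htoo
      obtain ⟨v, hv, hvm⟩ := hDIt (outwardNormal (Y t) (x t))
      refine le_mul_norm_outwardNormal_of_hasDerivAt
        (eventually_of_mem (Icc_mem_nhds htoo.1 htoo.2) hY) hxt hv (fun hne => ?_) hd'
      exact ((hμ t ht _ hne).inner_outwardNormal_rhs_le hg hW (hw t) (hY t ht) (hYxB t ht).1
        (hYxB t ht).2 (hK _ (hμU t ht _) _ (hw t))).trans (by gcongr)) ht
  have hda : outwardNormal (Y a) (x a) = 0 :=
    (hY a ⟨le_rfl, ht.1.trans ht.2⟩).outwardNormal_eq_zero_iff.2 hxa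
  rw [hda, norm_zero, zero_mul] at hgronwall
  exact (hY t ht).outwardNormal_eq_zero_iff.1 (norm_le_zero_iff.1 hgronwall)

theorem exists_measurable_feedback_isNearMinimizing {Y : ℝ → Set (Eu nx)} {t₁ t₂ : ℝ}
    (h12 : t₁ ≤ t₂) (hg : Continuous fun p : Eu nx × Eu nu × Eu nw => rhs f G p.1 p.2.1 p.2.2)
    (hU : IsCompact U) (hUne : U.Nonempty) (hW : IsCompact W) (hWne : W.Nonempty)
    (hY : ∀ t ∈ Icc t₁ t₂, IsConvexBody (Y t))
    (hV : ∀ c, ContinuousOn (fun t => supportFn (Y t) c) (Icc t₁ t₂)) :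
    ∃ μ : ℝ → Eu nx → Eu nu, Measurable (fun p : ℝ × Eu nx => μ p.1 p.2) ∧ (∀ t x, μ t x ∈ U) ∧
      ∀ t ∈ Icc t₁ t₂, ∀ x, outwardNormal (Y t) x ≠ 0 →
        IsNearMinimizing f G U W (Y t) x (μ t x) := by
  obtain ⟨μ, hμ, hmin⟩ := exists_measurable_isNearMinimizing (Y := fun t : Icc t₁ t₂ => Y t)
    hg hU hUne hW hWne (fun t => hY t t.2) (fun c => (hV c).domRestrict)
  refine ⟨fun t x => μ (projIcc t₁ t₂ h12 t, x),
    measurable_subtype_coe.comp (hμ.comp (by fun_prop)), fun _ _ => (μ _).2, fun t ht x hx => ?_⟩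
  simpa only [projIcc_of_mem h12 ht] using hmin ⟨t, ht⟩ x hx

theorem isRFIT_of_nonempty_imp_not_le {Y : ℝ → Set (Eu nx)} {t₁ t₂ : ℝ} (hU : U.Nonempty)
    (h : W.Nonempty → ¬ t₁ ≤ t₂) : IsRFIT f G U W t₁ t₂ Y := by
  obtain ⟨u, hu⟩ := hU
  refine ⟨fun _ _ => u, measurable_const, (locallyIntegrable_const u).locallyIntegrableOn _,
    fun _ _ _ => hu, fun w hw a b ha hab hb => ?_⟩
  exact absurd (ha.trans (hab.trans hb)) (h ⟨w a, hw.2 a⟩)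

end Invariance

end MinMaxDI

open MinMaxDI in
theorem theorem2_general {nx nu nw : ℕ} (f : Eu nx → Eu nw → Eu nx)
    (G : Eu nx → (Eu nu →L[ℝ] Eu nx)) (U : Set (Eu nu)) (W : Set (Eu nw)) (hUcompact : IsCompact U)
    (hUne : U.Nonempty) (hWcompact : IsCompact W)
    (hf : Continuous (fun p : Eu nx × Eu nw => f p.1 p.2)) (hfLip : LocLipschitzInState f)
    (hG : LocallyLipschitz G) (t₁ t₂ : ℝ) (Y : ℝ → Set (Eu nx))
    (hY : ∀ t ∈ Icc t₁ t₂, (Y t).Nonempty ∧ IsCompact (Y t) ∧ Convex ℝ (Y t))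
    (hV : ∀ c, ∀ a ∈ Icc t₁ t₂, ∀ b ∈ Icc t₁ t₂,
      AbsolutelyContinuousOnInterval (fun t => supportFn (Y t) c) a b)
    (hDI : ∀ᵐ t ∂(volume.restrict (Icc t₁ t₂)), ∀ c : Eu nx,
      ∃ v : ℝ, HasDerivAt (fun s => supportFn (Y s) c) v t ∧ v ≥ minMax f G U W c (Y t)) :
    IsRFIT f G U W t₁ t₂ Y := by
  by_cases hne : W.Nonempty ∧ t₁ ≤ t₂
  swap
  · exact isRFIT_of_nonempty_imp_not_le hUne fun hWne h12 => hne ⟨hWne, h12⟩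
  obtain ⟨hWne, h12⟩ := hne
  have hbody : ∀ t ∈ Icc t₁ t₂, IsConvexBody (Y t) := fun t ht =>
    ⟨(hY t ht).1, (hY t ht).2.1, (hY t ht).2.2⟩
  have hVcont : ∀ c, ContinuousOn (fun t => supportFn (Y t) c) (Icc t₁ t₂) := fun c =>
    uIcc_of_le h12 ▸ (hV c _ (left_mem_Icc.2 h12) _ (right_mem_Icc.2 h12)).continuousOn
  obtain ⟨μ, hμ, hμU, hμmin⟩ := exists_measurable_feedback_isNearMinimizing h12
    (continuous_rhs hf hG.continuous) hUcompact hUne hWcompact hWne hbody hVcont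
  refine ⟨μ, hμ, (locallyIntegrable_of_measurable_of_mem hμ hUcompact.isBounded
    fun p => hμU p.1 p.2).locallyIntegrableOn _, fun t _ => hμU t, ?_⟩
  intro w hw a b ha hab hb x hx hxa t ht
  have hsub : Icc a b ⊆ Icc t₁ t₂ := Icc_subset_Icc ha hb
  exact mem_tube_of_isSolution hf hfLip hG hUcompact hWcompact (fun t ht => hbody t (hsub ht))
    (fun c => hV c a (hsub (left_mem_Icc.2 hab)) b (hsub (right_mem_Icc.2 hab)))
    (ae_restrict_of_ae_restrict_of_subset hsub hDI) (fun t _ => hμU t)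
    (fun t ht => hμmin t (hsub ht)) hw.2 hx hxa ht

theorem theorem2 {nx nu nw : ℕ}
    (f : MinMaxDI.Eu nx → MinMaxDI.Eu nw → MinMaxDI.Eu nx)
    (G : MinMaxDI.Eu nx → (MinMaxDI.Eu nu →L[ℝ] MinMaxDI.Eu nx))
    (U : Set (MinMaxDI.Eu nu)) (W : Set (MinMaxDI.Eu nw))
    (hUcompact : IsCompact U) (hUconvex : Convex ℝ U) (hUint : (interior U).Nonempty)
    (hWcompact : IsCompact W) (hWconvex : Convex ℝ W)
    (hf : Continuous (fun p : MinMaxDI.Eu nx × MinMaxDI.Eu nw => f p.1 p.2))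
    (hfLip : MinMaxDI.LocLipschitzInState f)
    (hG : ContDiff ℝ 1 G)
    (t₁ t₂ : ℝ) (Y : ℝ → Set (MinMaxDI.Eu nx))
    (hY : ∀ t ∈ Icc t₁ t₂, (Y t).Nonempty ∧ IsCompact (Y t) ∧ Convex ℝ (Y t))
    (hLip : ∀ c : MinMaxDI.Eu nx, ∃ K : NNReal,
      LipschitzOnWith K (fun t => MinMaxDI.supportFn (Y t) c) (Icc t₁ t₂))
    (hDI : ∀ᵐ t ∂(volume.restrict (Icc t₁ t₂)), ∀ c : MinMaxDI.Eu nx,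
      ∃ v : ℝ, HasDerivAt (fun s => MinMaxDI.supportFn (Y s) c) v t ∧
        v ≥ MinMaxDI.minMax f G U W c (Y t)) :
    MinMaxDI.IsRFIT f G U W t₁ t₂ Y :=
  theorem2_general f G U W hUcompact (hUint.mono interior_subset) hWcompact hf hfLip
    hG.locallyLipschitz t₁ t₂ Y hY
    (fun c _ ha _ hb => (hLip c).elim fun _ hK =>
      (hK.mono (uIcc_subset_Icc ha hb)).absolutelyContinuousOnInterval) hDI
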